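/- **Setting.** A *concept class* over a set $\mathcal X$ of contexts is a set $\mathcal F$ of functions $f:\mathcal X\to\{+1,-1,\mathtt{null}\}$. Its *diameter* $d_{\mathcal F}\in\mathbb N\cup\{\infty\}$ is the supremum of the lengths $m$ of sequences $x_1,\dots,x_m\in\mathcal X$ such that for every $t\le m$ there is $f\in\mathcal F$ with $f(x_t)=+1$ and $f(x_s)=-1$ for all $s<t$. We consider only classes for which some $f\in\mathcal F$ takes both values $+1$ and $-1$. An *instance* with $T$ rounds, $n$ arms and concept class $\mathcal F$ consists of click probabilities $p_t(i)\in[0,1]$, contexts $x_t\in\mathcal X$ (for $1\le t\le T$, $1\le i\le n$) and a concept $f\in\mathcal F$ such that $f(x_t)=+1$ if round $t$ is an event and $f(x_t)=-1$ otherwise; here an *event* is a round $t\ge 2$ with $p_{t-1}\ne p_t$. An arm $i$ is *optimal* in round $t$ if it maximizes $p_t$; we write $i_t^*$ for an optimal arm. The instance has *minimum shift* $\varepsilon_S$ if at every event $t$ some arm $i$ that is optimal in round $t-1$ satisfies $p_t(i)<p_t(i_t^*)-\varepsilon_S$. Its *minimum suboptimality* is $\Delta=\min_t\min_{i\ne i_t^*}\big(p_t(i_t^*)-p_t(i)\big)$.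 An *eventful bandit algorithm* is a (randomized) rule that in each round $t$ chooses an arm $i_t$ from the arms and clicks of the previous rounds and the contexts $x_1,\dots,x_t$; arm $i_t$ is then clicked with probability $p_t(i_t)$. The algorithm may depend on $T$, $n$, $\mathcal F$ and all other parameters below, but not on the instance. Its *regret* on the instance is $R_{\mathcal A}(T)=\mathbb E\big[\sum_{t=1}^T p_t(i_t^*)-p_t(i_t)\big]$. **Theorem.** (i) There is an absolute constant $c>0$ such that for all $n\ge 3$ and $\varepsilon\in(0,\tfrac14)$ there is $\tau=\tau(n,\varepsilon)$ with the following property. For all $k\ge 1$ and $T\ge \tau k$, every concept class $\mathcal F$ as above and every eventful bandit algorithm $\mathcal A$, there is an instance with $T$ rounds, $n$ arms, concept class $\mathcal F$, exactly $k$ events, minimum shift $\varepsilon_S=\varepsilon$ and minimum suboptimality $\Delta=\varepsilon$ such that $$R_{\mathcal A}(T)\ \ge\ c\,\frac{k\,n}{\varepsilon}\,\log\frac{T}{k}.$$ (ii) There are absolute constants $c,\varepsilon_S,\Delta>0$ and $T_0$ such that for all $T\ge T_0$, every concept class $\mathcal F$ as above and every eventful bandit algorithm $\mathcal A$, there is an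 instance with $T$ rounds, two arms, concept class $\mathcal F$, exactly one event, minimum shift $\varepsilon_S$ and minimum suboptimality $\Delta$ such that $$R_{\mathcal A}(T)\ \ge\ c\,T^{1/3}\qquad\text{or}\qquad d_{\mathcal F}<\infty\ \text{ and }\ R_{\mathcal A}(T)\ \ge\ c\,d_{\mathcal F}\log T .$$ -/

import Mathlib

universe u

/-- The values of a concept: `pos` is `+1`, `neg` is `-1`, and `null` marks a context that is
not feasible under the concept. -/
inductive EventLabel : Type
  | pos
  | neg
  | null

namespace EventfulBandit

/-- `x 0, …, x (m-1)` is a sequence such that for every `t` some concept of the class is `+1` at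
`x t` and `-1` at all the earlier members. -/
def IsDiameterSeq {X : Type u} (F : Set (X → EventLabel)) (m : ℕ) (x : Fin m → X) : Prop :=
  ∀ t : Fin m, ∃ f ∈ F, f (x t) = EventLabel.pos ∧ ∀ s < t, f (x s) = EventLabel.neg

/-- The diameter of a concept class: the length of the longest sequence as above (`⊤` if there are
arbitrarily long ones). -/
noncomputable def diameter {X : Type u} (F : Set (X → EventLabel)) : ℕ∞ :=
  ⨆ (m : ℕ) (_ : ∃ x : Fin m → X, IsDiameterSeq F m x), (m : ℕ∞)

/-- Some concept of the class takes both values `+1` and `-1`. -/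
def Nondegenerate {X : Type u} (F : Set (X → EventLabel)) : Prop :=
  ∃ f ∈ F, (∃ a, f a = EventLabel.pos) ∧ (∃ b, f b = EventLabel.neg)

/-- Rounds are numbered `0, 1, 2, …`; an event is a round other than the first one in which the
vector of click probabilities differs from that of the round before. -/
def IsEvent {n : ℕ} (p : ℕ → Fin n → unitInterval) (t : ℕ) : Prop :=
  ∃ s, t = s + 1 ∧ p s ≠ p t

/-- An instance with concept class `F`, rounds `0, …, T-1` and arms `0, …, n-1`: the click
probabilities, the contexts, and an event oracle in `F` (values at rounds `t ≥ T` are never used). -/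
structure Instance {X : Type u} (F : Set (X → EventLabel)) (T n : ℕ) where
  p : ℕ → Fin n → unitInterval
  x : ℕ → X
  f : X → EventLabel
  f_mem : f ∈ F
  oracle_pos : ∀ t < T, IsEvent p t → f (x t) = EventLabel.pos
  oracle_neg : ∀ t < T, ¬ IsEvent p t → f (x t) = EventLabel.neg

/-- The arm `i` has the maximum click probability. -/
def IsOptimal {n : ℕ} (q : Fin n → unitInterval) (i : Fin n) : Prop :=
  ∀ j, q j ≤ q i

/-- The maximum click probability. -/
noncomputable def best {n : ℕ} (q : Fin n → unitInterval) : ℝ :=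
  ⨆ i, (q i : ℝ)

section Instances

variable {X : Type u} {F : Set (X → EventLabel)} {T n : ℕ}

/-- The number of events among the `T` rounds. -/
noncomputable def numEvents (I : Instance F T n) : ℕ :=
  Set.ncard {t | t < T ∧ IsEvent I.p t}

/-- At each event, some arm that was optimal before it is more than `ε` below the optimum
after it. -/
def HasMinShift (I : Instance F T n) (ε : ℝ) : Prop :=
  ∀ t, t + 1 < T → I.p t ≠ I.p (t + 1) →
    ∃ i, IsOptimal (I.p t) i ∧ (I.p (t + 1) i : ℝ) < best (I.p (t + 1)) - ε

/-- `Δ` is the minimum, over all rounds, of the gap between an optimal arm and any other arm. -/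
def HasMinSuboptimality (I : Instance F T n) (Δ : ℝ) : Prop :=
  IsLeast {δ : ℝ | ∃ t < T, ∃ i j, IsOptimal (I.p t) i ∧ j ≠ i ∧
    δ = (I.p t i : ℝ) - (I.p t j : ℝ)} Δ

end Instances

/-- A (randomized) eventful bandit algorithm: in round `t` the distribution of the arm is a
function of the arms and clicks of rounds `0, …, t-1` and the contexts of rounds `0, …, t`. -/
structure Algorithm (X : Type u) (n : ℕ) where
  choose : (t : ℕ) → (Fin t → Fin n × Bool) → (Fin (t + 1) → X) → PMF (Fin n)

/-- A click (`true`) with probability `q`. -/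
noncomputable def click (q : unitInterval) : PMF Bool :=
  PMF.ofFintype (fun b => ENNReal.ofReal (if b then (q : ℝ) else 1 - (q : ℝ))) (by
    rw [Fintype.sum_bool, ← ENNReal.ofReal_add] <;> simp [q.2.1, q.2.2])

section Play

variable {X : Type u} {F : Set (X → EventLabel)} {T n : ℕ}

/-- The law of the arms and clicks of the first `t` rounds when `A` plays on `I`. -/
noncomputable def law (A : Algorithm X n) (I : Instance F T n) :
    (t : ℕ) → PMF (Fin t → Fin n × Bool)
  | 0 => PMF.pure Fin.elim0
  | t + 1 =>
    (law A I t).bind fun h =>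
      (A.choose t h fun s => I.x s).bind fun i =>
        (click (I.p t i)).map fun b =>
          (Fin.snoc h (i, b) : Fin (t + 1) → Fin n × Bool)

/-- The regret `E[∑ₜ pₜ(iₜ*) - pₜ(iₜ)]` of `A` on `I` over the `T` rounds. -/
noncomputable def regret (A : Algorithm X n) (I : Instance F T n) : ℝ :=
  ∑ h : Fin T → Fin n × Bool,
    (law A I T h).toReal * ∑ t : Fin T, (best (I.p t) - (I.p t (h t).1 : ℝ))

end Play

end EventfulBandit

/-!
Both lower bounds rest on one change of measure. Let `P` and `P'` be the laws of the history in two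
environments that differ, over `L` rounds, only in the click probability of an arm `i₀`, and such
that no arm is good in both. The log-likelihood ratio `Λ` is a sum over the plays of `i₀`, and its
expectation under `P` is at least `-κ E[N]`, where `N` is the number of these plays and `κ` bounds
the divergence of the two click distributions. As the regrets in the two environments add up to at
least `δ L` along every history, the expected regrets add up to at least
`δ L exp (-κ E[N] - 1)` (`mul_exp_le_sum_roundRegret_add`). Hence either `E[N] ≥ log L / (2 κ)`, or
one of the environments costs a multiple of `√L` (`log_le_or_sqrt_le_sum_roundRegret_add`). No
consistency of the algorithm is assumed.

For the first bound, the events are announced by the contexts and split the rounds into phases of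
length about `T / k`. In each phase the formerly optimal arm is demoted, and any of the `n - 2` arms
other than it and the new optimum may secretly be `ε` better than that optimum; distinguishing
these takes `log (T / k) / ε ^ 2` plays of each of them, at cost `ε` (`exists_phase`). As the regret
in a phase does not depend on what comes later, the phases are chosen one after the other
(`exists_phases`).

For the second bound there are two arms, and the event makes the second, formerly inferior one
superior, without a change in the first one. The members of a diameter sequence are shown at
intervals of `L` rounds, with its first member as the context in between. Until the next member is
shown the contexts do not reveal whether there was an event, so that after each of the members the
second arm has to be played about `log L` times, or else the regret is of order `√L` for one
position of the event (`exists_instance_of_isDiameterSeq`). With `m` the minimum of the diameter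
and `T ^ (1 / 3)`, and `L = T / m`, the former costs `m log L` and the latter
`√L ≥ T ^ (1 / 3) / 2`. Diameters below `3` are covered by the ordinary logarithmic lower bound for
two arms, with the event in the last round (`exists_instance_of_unknown_arm`).
-/

namespace EventfulBandit

/-! ### The law of the history and the regret per round -/

section Histories

variable {X : Type u} {n : ℕ}

/-- The probability of the click value `b` when the click probability is `q`. -/
noncomputable def clickProb (q : unitInterval) (b : Bool) : ℝ :=
  if b then (q : ℝ) else 1 - (q : ℝ)

/-- The probability that the arms and clicks of the first `t` rounds are `h`, for arbitrary click
probabilities `p` and contexts `x`, not necessarily those of an instance. -/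
noncomputable def weight (A : Algorithm X n) (p : ℕ → Fin n → unitInterval) (x : ℕ → X) :
    (t : ℕ) → (Fin t → Fin n × Bool) → ℝ
  | 0, _ => 1
  | t + 1, h =>
    weight A p x t (Fin.init h) *
      ((A.choose t (Fin.init h) fun s => x s) (h (Fin.last t)).1).toReal *
      clickProb (p t (h (Fin.last t)).1) (h (Fin.last t)).2

/-- The probability that arm `i` is played in round `t`. -/
noncomputable def playProb (A : Algorithm X n) (p : ℕ → Fin n → unitInterval) (x : ℕ → X)
    (t : ℕ) (i : Fin n) : ℝ :=
  ∑ h : Fin t → Fin n × Bool, weight A p x t h * ((A.choose t h fun s => x s) i).toReal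

/-- The expected regret incurred in round `t`. -/
noncomputable def roundRegret (A : Algorithm X n) (p : ℕ → Fin n → unitInterval) (x : ℕ → X)
    (t : ℕ) : ℝ :=
  ∑ i, playProb A p x t i * (best (p t) - (p t i : ℝ))

theorem clickProb_nonneg (q : unitInterval) (b : Bool) : 0 ≤ clickProb q b := by
  cases b
  · simpa [clickProb] using q.2.2
  · simpa [clickProb] using q.2.1

theorem sum_clickProb (q : unitInterval) : ∑ b, clickProb q b = 1 := by
  simp [clickProb]

theorem click_apply_toReal (q : unitInterval) (b : Bool) :
    (click q b).toReal = clickProb q b :=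
  ENNReal.toReal_ofReal (clickProb_nonneg q b)

theorem sum_pmf_toReal {α : Type*} [Fintype α] (μ : PMF α) : ∑ a, (μ a).toReal = 1 := by
  rw [← ENNReal.toReal_sum fun a _ => μ.apply_ne_top a,
    ← tsum_fintype (L := SummationFilter.unconditional α), μ.tsum_coe,
    ENNReal.toReal_one]

theorem sum_history_succ {α M : Type*} [Fintype α] [AddCommMonoid M] (t : ℕ)
    (F : (Fin (t + 1) → α) → M) :
    ∑ h, F h = ∑ h : Fin t → α, ∑ a, F (Fin.snoc h a : Fin (t + 1) → α) := by
  rw [← Fintype.sum_prod_type_right']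
  exact (Fintype.sum_equiv (Fin.snocEquiv fun _ => α) _ _ fun _ => rfl).symm

variable (A : Algorithm X n) (p p' : ℕ → Fin n → unitInterval) (x x' : ℕ → X)

theorem weight_snoc (t : ℕ) (h : Fin t → Fin n × Bool) (a : Fin n × Bool) :
    weight A p x (t + 1) (Fin.snoc h a : Fin (t + 1) → Fin n × Bool) =
      weight A p x t h * ((A.choose t h fun s => x s) a.1).toReal * clickProb (p t a.1) a.2 := by
  simp [weight]

theorem weight_nonneg (t : ℕ) (h : Fin t → Fin n × Bool) : 0 ≤ weight A p x t h := by
  induction t with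
  | zero => simp [weight]
  | succ t ih =>
    exact mul_nonneg (mul_nonneg (ih _) ENNReal.toReal_nonneg) (clickProb_nonneg _ _)

theorem playProb_nonneg (t : ℕ) (i : Fin n) : 0 ≤ playProb A p x t i :=
  Finset.sum_nonneg fun _ _ => mul_nonneg (weight_nonneg ..) ENNReal.toReal_nonneg

theorem sum_weight (t : ℕ) : ∑ h, weight A p x t h = 1 := by
  induction t with
  | zero => simp [weight]
  | succ t ih =>
    rw [sum_history_succ, ← ih]
    refine Finset.sum_congr rfl fun h _ => ?_
    simp only [weight_snoc, Fintype.sum_prod_type, ← Finset.mul_sum, sum_clickProb, mul_one,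
      sum_pmf_toReal]

theorem sum_playProb (t : ℕ) : ∑ i, playProb A p x t i = 1 := by
  simp only [playProb]
  rw [Finset.sum_comm]
  simp only [← Finset.mul_sum, sum_pmf_toReal, mul_one, sum_weight]

/-- The expectation of a sum, over the rounds, of functions of the arm and the click. -/
theorem sum_weight_mul_sum (g : ℕ → Fin n × Bool → ℝ) (T : ℕ) :
    ∑ h : Fin T → Fin n × Bool, weight A p x T h * ∑ t : Fin T, g t (h t) =
      ∑ t ∈ Finset.range T, ∑ i, playProb A p x t i *
        ∑ b, clickProb (p t i) b * g t (i, b) := by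
  induction T with
  | zero => simp
  | succ T ih =>
    have key (h : Fin T → Fin n × Bool) :
        ∑ a, weight A p x (T + 1) (Fin.snoc h a : Fin (T + 1) → Fin n × Bool) *
            ∑ t : Fin (T + 1), g t ((Fin.snoc h a : Fin (T + 1) → Fin n × Bool) t) =
          weight A p x T h * ∑ t : Fin T, g t (h t) +
            ∑ i, weight A p x T h * ((A.choose T h fun s => x s) i).toReal *
              ∑ b, clickProb (p T i) b * g T (i, b) := by
      simp only [weight_snoc, Fin.sum_univ_castSucc, Fin.snoc_castSucc, Fin.snoc_last,
        Fin.val_castSucc, Fin.val_last, Fintype.sum_prod_type, mul_add, Finset.sum_add_distrib]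
      congr 1
      · simp only [← Finset.sum_mul, ← Finset.mul_sum, sum_clickProb, mul_one, sum_pmf_toReal]
      · simp only [mul_assoc, ← Finset.mul_sum]
    rw [sum_history_succ, Finset.sum_range_succ, ← ih]
    simp only [key, Finset.sum_add_distrib, playProb, Finset.sum_mul]
    rw [Finset.sum_comm (s := Finset.univ (α := Fin n))]

theorem weight_congr {t : ℕ} (hp : ∀ s < t, p s = p' s) (hx : ∀ s < t, x s = x' s)
    (h : Fin t → Fin n × Bool) : weight A p x t h = weight A p' x' t h := by
  induction t with
  | zero => rfl
  | succ t ih =>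
    have : (fun s : Fin (t + 1) => x s) = fun s : Fin (t + 1) => x' s :=
      funext fun s => hx s s.2
    simp only [weight, hp t t.lt_succ_self, this,
      ih (fun s hs => hp s (hs.trans t.lt_succ_self)) (fun s hs => hx s (hs.trans t.lt_succ_self))]

theorem playProb_congr {t : ℕ} (hp : ∀ s < t, p s = p' s) (hx : ∀ s ≤ t, x s = x' s)
    (i : Fin n) : playProb A p x t i = playProb A p' x' t i := by
  have : (fun s : Fin (t + 1) => x s) = fun s : Fin (t + 1) => x' s :=
    funext fun s => hx s (Nat.lt_succ_iff.1 s.2)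
  simp only [playProb, this, weight_congr A p p' x x' hp fun s hs => hx s hs.le]

theorem roundRegret_congr {t : ℕ} (hp : ∀ s ≤ t, p s = p' s) (hx : ∀ s ≤ t, x s = x' s) :
    roundRegret A p x t = roundRegret A p' x' t := by
  simp only [roundRegret, hp t le_rfl, playProb_congr A p p' x x' (fun s hs => hp s hs.le) hx]

theorem le_best (q : Fin n → unitInterval) (i : Fin n) : (q i : ℝ) ≤ best q :=
  le_ciSup (f := fun i => (q i : ℝ)) (Set.finite_range _).bddAbove i

theorem best_eq {q : Fin n → unitInterval} {i : Fin n} (hi : IsOptimal q i) :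
    best q = (q i : ℝ) := by
  have : Nonempty (Fin n) := ⟨i⟩
  exact le_antisymm (ciSup_le fun j => hi j) (le_best q i)

theorem roundRegret_nonneg (t : ℕ) : 0 ≤ roundRegret A p x t :=
  Finset.sum_nonneg fun i _ =>
    mul_nonneg (playProb_nonneg ..) (sub_nonneg.2 (le_best _ i))

/-- The arms of `S`, each at least `δ` below the optimum, contribute `δ` per play. -/
theorem mul_sum_playProb_le_roundRegret {t : ℕ} {δ : ℝ} (S : Finset (Fin n))
    (h : ∀ i ∈ S, δ ≤ best (p t) - (p t i : ℝ)) :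
    δ * ∑ i ∈ S, playProb A p x t i ≤ roundRegret A p x t := by
  calc δ * ∑ i ∈ S, playProb A p x t i
      = ∑ i ∈ S, playProb A p x t i * δ := by rw [Finset.mul_sum]; simp only [mul_comm]
    _ ≤ ∑ i ∈ S, playProb A p x t i * (best (p t) - (p t i : ℝ)) :=
        Finset.sum_le_sum fun i hi => mul_le_mul_of_nonneg_left (h i hi) (playProb_nonneg ..)
    _ ≤ roundRegret A p x t :=
        Finset.sum_le_sum_of_subset_of_nonneg (Finset.subset_univ S) fun i _ _ =>
          mul_nonneg (playProb_nonneg ..) (sub_nonneg.2 (le_best _ i))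

theorem law_apply_toReal {F : Set (X → EventLabel)} {T : ℕ} (I : Instance F T n) (t : ℕ)
    (h : Fin t → Fin n × Bool) : (law A I t h).toReal = weight A I.p I.x t h := by
  induction t with
  | zero => simp [law, weight, PMF.pure_apply, Subsingleton.elim h Fin.elim0]
  | succ t ih =>
    have key : law A I (t + 1) h = law A I t (Fin.init h) *
        ((A.choose t (Fin.init h) fun s => I.x s) (h (Fin.last t)).1 *
          click (I.p t (h (Fin.last t)).1) (h (Fin.last t)).2) := by
      have hs (h' : Fin t → Fin n × Bool) (i : Fin n) (b : Bool) :
          h = (Fin.snoc h' (i, b) : Fin (t + 1) → Fin n × Bool) ↔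
            h' = Fin.init h ∧ i = (h (Fin.last t)).1 ∧ b = (h (Fin.last t)).2 := by
        constructor
        · rintro rfl
          simp
        · rintro ⟨rfl, rfl, rfl⟩
          exact (Fin.snoc_init_self h).symm
      simp only [law, PMF.bind_apply, PMF.map_apply, hs]
      rw [tsum_eq_single (Fin.init h) fun h' hne => by simp [hne],
        tsum_eq_single (h (Fin.last t)).1 fun i hne => by simp [hne],
        tsum_eq_single (h (Fin.last t)).2 fun b hne => by simp [hne]]
      simp
    rw [key, ENNReal.toReal_mul, ENNReal.toReal_mul, ih, click_apply_toReal, weight, mul_assoc]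

theorem regret_eq_sum_roundRegret {F : Set (X → EventLabel)} {T : ℕ} (I : Instance F T n) :
    regret A I = ∑ t ∈ Finset.range T, roundRegret A I.p I.x t := by
  simp only [regret, law_apply_toReal, roundRegret]
  rw [sum_weight_mul_sum A I.p I.x fun t a => best (I.p t) - (I.p t a.1 : ℝ)]
  simp only [← Finset.sum_mul, sum_clickProb, one_mul]

end Histories

/-! ### Change of measure -/

section TwoPoint

/-- Two hypotheses with likelihood ratio `exp Λ` cannot both have small loss if one of the losses
`r`, `r'` is large at every outcome. The factor `exp (E[Λ] - 1)` comes from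
`min 1 (exp Λ) ≥ exp (Λ - exp Λ)` and Jensen's inequality. -/
theorem mul_exp_sum_le_add {ι : Type*} [Fintype ι] {P Λ r r' : ι → ℝ} {G : ℝ}
    (hP : ∀ h, 0 ≤ P h) (hP1 : ∑ h, P h = 1) (hQ1 : ∑ h, P h * Real.exp (Λ h) = 1)
    (hr : ∀ h, 0 ≤ r h) (hr' : ∀ h, 0 ≤ r' h) (hG : 0 ≤ G) (hrr : ∀ h, G ≤ r h + r' h) :
    G * Real.exp (∑ h, P h * Λ h - 1) ≤
      ∑ h, P h * r h + ∑ h, P h * Real.exp (Λ h) * r' h := by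
  set m := ∑ h, P h * Λ h - 1 with hm
  have pt (h : ι) : P h * (G * (Real.exp m * (1 + (Λ h - Real.exp (Λ h) - m)))) ≤
      P h * r h + P h * Real.exp (Λ h) * r' h := by
    have hΛ := Real.add_one_le_exp (Λ h)
    have h1 : Real.exp m * (1 + (Λ h - Real.exp (Λ h) - m)) ≤
        Real.exp (Λ h - Real.exp (Λ h)) := by
      have := Real.add_one_le_exp (Λ h - Real.exp (Λ h) - m)
      calc _ ≤ Real.exp m * Real.exp (Λ h - Real.exp (Λ h) - m) :=
            mul_le_mul_of_nonneg_left (by linarith) (Real.exp_pos _).le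
        _ = _ := by rw [← Real.exp_add]; ring_nf
    have h2 : Real.exp (Λ h - Real.exp (Λ h)) ≤ 1 := Real.exp_le_one_iff.2 (by linarith)
    have h3 : Real.exp (Λ h - Real.exp (Λ h)) ≤ Real.exp (Λ h) :=
      Real.exp_le_exp.2 (by linarith [Real.exp_pos (Λ h)])
    have h4 : G * Real.exp (Λ h - Real.exp (Λ h)) ≤ r h + Real.exp (Λ h) * r' h :=
      calc _ ≤ (r h + r' h) * Real.exp (Λ h - Real.exp (Λ h)) :=
            mul_le_mul_of_nonneg_right (hrr h) (Real.exp_pos _).le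
        _ = r h * Real.exp (Λ h - Real.exp (Λ h)) +
              Real.exp (Λ h - Real.exp (Λ h)) * r' h := by ring
        _ ≤ _ := add_le_add (mul_le_of_le_one_right (hr h) h2)
            (mul_le_mul_of_nonneg_right h3 (hr' h))
    calc _ ≤ P h * (r h + Real.exp (Λ h) * r' h) := mul_le_mul_of_nonneg_left
          ((mul_le_mul_of_nonneg_left h1 hG).trans h4) (hP h)
      _ = _ := by ring
  rw [← Finset.sum_add_distrib]
  refine le_trans (le_of_eq ?_) (Finset.sum_le_sum fun h _ => pt h)
  have e (h : ι) : P h * (G * (Real.exp m * (1 + (Λ h - Real.exp (Λ h) - m)))) =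
      G * Real.exp m * (P h * (1 - m) + P h * Λ h - P h * Real.exp (Λ h)) := by ring
  simp only [e, ← Finset.mul_sum, Finset.sum_add_distrib, Finset.sum_sub_distrib, hQ1,
    ← Finset.sum_mul, hP1]
  rw [hm]
  ring

variable {X : Type u} {n : ℕ} (A : Algorithm X n) (p p' : ℕ → Fin n → unitInterval) (x : ℕ → X)

theorem weight_eq_weight_mul_exp {ℓ : ℕ → Fin n × Bool → ℝ} {T : ℕ}
    (hℓ : ∀ t < T, ∀ i b, clickProb (p' t i) b = clickProb (p t i) b * Real.exp (ℓ t (i, b)))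
    (h : Fin T → Fin n × Bool) :
    weight A p' x T h = weight A p x T h * Real.exp (∑ t : Fin T, ℓ t (h t)) := by
  induction T with
  | zero => simp [weight]
  | succ T ih =>
    rw [Fin.sum_univ_castSucc, Real.exp_add, weight, weight,
      hℓ T T.lt_succ_self, ih fun t ht => hℓ t (ht.trans T.lt_succ_self)]
    simp only [Fin.init, Fin.val_castSucc, Fin.val_last]
    ring

/-- The Kullback–Leibler divergence between Bernoulli distributions is at most the `χ²`
divergence. -/
theorem neg_le_sum_clickProb_mul_log {q q' : unitInterval} {κ : ℝ} (hq : 0 < (q : ℝ))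
    (hq1 : (q : ℝ) < 1) (hq' : 0 < (q' : ℝ)) (hq1' : (q' : ℝ) < 1)
    (hκ : ((q : ℝ) - q') ^ 2 ≤ κ * (q' * (1 - q'))) :
    -κ ≤ ∑ b, clickProb q b * Real.log (clickProb q' b / clickProb q b) := by
  have hlog {a b : ℝ} (ha : 0 < a) (hb : 0 < b) : a * (1 - a / b) ≤ a * Real.log (b / a) := by
    have := Real.one_sub_inv_le_log_of_pos (div_pos hb ha)
    rw [inv_div] at this
    exact mul_le_mul_of_nonneg_left this ha.le
  have h1 := hlog hq hq'
  have h2 := hlog (sub_pos.2 hq1) (sub_pos.2 hq1')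
  have hne : (1 - (q' : ℝ)) ≠ 0 := (sub_pos.2 hq1').ne'
  have e : (q : ℝ) * (1 - q / q') + (1 - q) * (1 - (1 - q) / (1 - q')) =
      -((q - q') ^ 2 / (q' * (1 - q'))) := by
    field_simp
    ring
  have h3 : ((q : ℝ) - q') ^ 2 / (q' * (1 - q')) ≤ κ :=
    (div_le_iff₀ (mul_pos hq' (sub_pos.2 hq1'))).2 hκ
  simp only [Fintype.sum_bool, clickProb, if_true, Bool.false_eq_true, if_false]
  linarith

/-- If two environments differ only in the click probability of the arm `i₀` in the rounds
`s, …, s + L - 1`, and no arm is good in both of them in any of these rounds, then an algorithm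
that seldom plays `i₀` in these rounds has large regret in one of them. -/
theorem mul_exp_le_sum_roundRegret_add {s L : ℕ} {i₀ : Fin n} {δ κ : ℝ} (hδ : 0 ≤ δ)
    (hagree : ∀ t < s + L, ∀ i, t < s ∨ i ≠ i₀ → p t i = p' t i)
    (hp : ∀ t ∈ Finset.Ico s (s + L), 0 < (p t i₀ : ℝ) ∧ (p t i₀ : ℝ) < 1)
    (hp' : ∀ t ∈ Finset.Ico s (s + L), 0 < (p' t i₀ : ℝ) ∧ (p' t i₀ : ℝ) < 1)
    (hκ : ∀ t ∈ Finset.Ico s (s + L),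
      ((p t i₀ : ℝ) - p' t i₀) ^ 2 ≤ κ * (p' t i₀ * (1 - p' t i₀)))
    (hgap : ∀ t ∈ Finset.Ico s (s + L), ∀ i,
      δ ≤ (best (p t) - p t i) + (best (p' t) - p' t i)) :
    δ * L * Real.exp (-(κ * ∑ t ∈ Finset.Ico s (s + L), playProb A p x t i₀) - 1) ≤
      ∑ t ∈ Finset.Ico s (s + L), roundRegret A p x t +
        ∑ t ∈ Finset.Ico s (s + L), roundRegret A p' x t := by
  set ℓ : ℕ → Fin n × Bool → ℝ := fun t a =>
    if s ≤ t ∧ a.1 = i₀ then Real.log (clickProb (p' t a.1) a.2 / clickProb (p t a.1) a.2)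
    else 0 with hℓdef
  have hIco : Finset.Ico s (s + L) = (Finset.range (s + L)).filter fun t => s ≤ t := by
    ext t
    simp [and_comm]
  have hpos {q : unitInterval} (hq : 0 < (q : ℝ) ∧ (q : ℝ) < 1) (b : Bool) :
      0 < clickProb q b := by
    cases b
    · simpa [clickProb] using hq.2
    · simpa [clickProb] using hq.1
  have hℓ : ∀ t < s + L, ∀ i b,
      clickProb (p' t i) b = clickProb (p t i) b * Real.exp (ℓ t (i, b)) := by
    intro t ht i b
    by_cases hc : s ≤ t ∧ i = i₀
    · obtain ⟨hst, rfl⟩ := hc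
      have hm := Finset.mem_Ico.2 ⟨hst, ht⟩
      have h1 := hpos (hp t hm) b
      have h2 := hpos (hp' t hm) b
      simp only [hℓdef, hst, and_self, if_true]
      rw [Real.exp_log (div_pos h2 h1), mul_div_cancel₀ _ h1.ne']
    · have : p t i = p' t i := hagree t ht i (by
        by_cases h : t < s
        · exact Or.inl h
        · exact Or.inr fun hi => hc ⟨not_lt.1 h, hi⟩)
      simp [hℓdef, hc, this]
  -- The regret of the rounds in question, as a function of the history.
  let g (q : ℕ → Fin n → unitInterval) (t : ℕ) (a : Fin n × Bool) : ℝ :=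
    if s ≤ t then best (q t) - (q t a.1 : ℝ) else 0
  have hg (q : ℕ → Fin n → unitInterval) :
      ∑ h : Fin (s + L) → Fin n × Bool,
          weight A q x (s + L) h * ∑ t : Fin (s + L), g q t (h t) =
        ∑ t ∈ Finset.Ico s (s + L), roundRegret A q x t := by
    rw [sum_weight_mul_sum A q x (g q), hIco, Finset.sum_filter]
    refine Finset.sum_congr rfl fun t _ => ?_
    by_cases hst : s ≤ t
    · simp only [g, hst, if_true, roundRegret, ← Finset.sum_mul, sum_clickProb, one_mul]
    · simp [g, hst]
  have hg0 (q : ℕ → Fin n → unitInterval) (t : ℕ) (a) : 0 ≤ g q t a := by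
    simp only [g]
    split_ifs
    · exact sub_nonneg.2 (le_best _ _)
    · exact le_rfl
  have hexp : ∑ h : Fin (s + L) → Fin n × Bool,
        weight A p x (s + L) h * ∑ t : Fin (s + L), ℓ t (h t) ≥
      -(κ * ∑ t ∈ Finset.Ico s (s + L), playProb A p x t i₀) := by
    rw [sum_weight_mul_sum A p x ℓ, hIco, Finset.sum_filter, Finset.mul_sum,
      ← Finset.sum_neg_distrib]
    refine Finset.sum_le_sum fun t ht => ?_
    by_cases hst : s ≤ t
    · have hm := Finset.mem_Ico.2 ⟨hst, Finset.mem_range.1 ht⟩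
      rw [Finset.sum_eq_single i₀ (fun i _ hi => by simp [hℓdef, hi]) (by simp)]
      simp only [hℓdef, hst, and_self, if_true]
      have := neg_le_sum_clickProb_mul_log (hp t hm).1 (hp t hm).2 (hp' t hm).1 (hp' t hm).2
        (hκ t hm)
      nlinarith [playProb_nonneg A p x t i₀]
    · simp [hℓdef, hst]
  have hmain := mul_exp_sum_le_add (P := weight A p x (s + L))
    (Λ := fun h => ∑ t : Fin (s + L), ℓ t (h t))
    (r := fun h => ∑ t : Fin (s + L), g p t (h t))
    (r' := fun h => ∑ t : Fin (s + L), g p' t (h t)) (G := δ * L)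
    (weight_nonneg A p x _) (sum_weight A p x _)
    (by
      rw [← sum_weight A p' x (s + L)]
      exact Finset.sum_congr rfl fun h _ => (weight_eq_weight_mul_exp A p p' x hℓ h).symm)
    (fun h => Finset.sum_nonneg fun t _ => hg0 _ _ _)
    (fun h => Finset.sum_nonneg fun t _ => hg0 _ _ _) (by positivity)
    (fun h => by
      rw [← Finset.sum_add_distrib]
      have hδ' : ∑ t : Fin (s + L), (if s ≤ (t : ℕ) then δ else 0) = δ * L := by
        rw [Fin.sum_univ_eq_sum_range fun t => if s ≤ t then δ else 0, ← Finset.sum_filter,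
          ← hIco, Finset.sum_const, Nat.card_Ico, Nat.add_sub_cancel_left, nsmul_eq_mul, mul_comm]
      rw [← hδ']
      refine Finset.sum_le_sum fun t _ => ?_
      by_cases hst : s ≤ (t : ℕ)
      · simpa only [g, hst, if_true] using hgap t (Finset.mem_Ico.2 ⟨hst, t.2⟩) (h t).1
      · simp [g, hst])
  simp only [← weight_eq_weight_mul_exp A p p' x hℓ, hg] at hmain
  refine le_trans (mul_le_mul_of_nonneg_left (Real.exp_le_exp.2 ?_) (by positivity)) hmain
  linarith

/-- The rate of `mul_exp_le_sum_roundRegret_add` for an algorithm that plays the arm `i₀` at most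
`log L / (2 κ)` times: the factor `exp (-(log L) / 2)` leaves `√L` out of `L`. -/
theorem log_le_or_sqrt_le_sum_roundRegret_add {s L : ℕ} {i₀ : Fin n} {δ κ : ℝ} (hL : 0 < L)
    (hδ : 0 ≤ δ)
    (hagree : ∀ t < s + L, ∀ i, t < s ∨ i ≠ i₀ → p t i = p' t i)
    (hp : ∀ t ∈ Finset.Ico s (s + L), 0 < (p t i₀ : ℝ) ∧ (p t i₀ : ℝ) < 1)
    (hp' : ∀ t ∈ Finset.Ico s (s + L), 0 < (p' t i₀ : ℝ) ∧ (p' t i₀ : ℝ) < 1)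
    (hκ : ∀ t ∈ Finset.Ico s (s + L),
      ((p t i₀ : ℝ) - p' t i₀) ^ 2 ≤ κ * (p' t i₀ * (1 - p' t i₀)))
    (hgap : ∀ t ∈ Finset.Ico s (s + L), ∀ i,
      δ ≤ (best (p t) - p t i) + (best (p' t) - p' t i)) :
    Real.log L ≤ 2 * κ * ∑ t ∈ Finset.Ico s (s + L), playProb A p x t i₀ ∨
      δ / 6 * √L ≤ ∑ t ∈ Finset.Ico s (s + L), roundRegret A p x t ∨
      δ / 6 * √L ≤ ∑ t ∈ Finset.Ico s (s + L), roundRegret A p' x t := by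
  rw [or_iff_not_imp_left]
  intro hlog
  have hmain := mul_exp_le_sum_roundRegret_add A p p' x hδ hagree hp hp' hκ hgap
  have hL' : (0 : ℝ) < L := by exact_mod_cast hL
  have h1 : Real.exp (-(Real.log L / 2)) * L = √L := by
    have h2 : Real.exp (Real.log L / 2) = √L := by
      rw [Real.exp_half, Real.exp_log hL']
    rw [Real.exp_neg, h2]
    nth_rewrite 2 [← Real.mul_self_sqrt hL'.le]
    field_simp
  have h3 : δ * L * (Real.exp (-(Real.log L / 2)) * Real.exp (-1)) ≤
      δ * L * Real.exp
        (-(κ * ∑ t ∈ Finset.Ico s (s + L), playProb A p x t i₀) - 1) := by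
    rw [← Real.exp_add]
    exact mul_le_mul_of_nonneg_left (Real.exp_le_exp.2 (by linarith)) (by positivity)
  have h4 : (1 : ℝ) / 3 ≤ Real.exp (-1) := by
    rw [Real.exp_neg, one_div]
    exact inv_anti₀ (Real.exp_pos _) (by linarith [Real.exp_one_lt_d9])
  have h5 : δ * L * (Real.exp (-(Real.log L / 2)) * Real.exp (-1)) =
      δ * √L * Real.exp (-1) := by rw [← h1]; ring
  have h6 : δ * √L * (1 / 3) ≤ δ * √L * Real.exp (-1) :=
    mul_le_mul_of_nonneg_left h4 (by positivity)
  by_contra! hcon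
  linarith [hcon.1, hcon.2]

end TwoPoint

/-! ### Gaps, shifts and blocks of rounds -/

section Gaps

variable {n : ℕ}

/-- Some arm has the largest click probability, and `ε` is the smallest of its gaps to the
other arms. -/
def HasGap (ε : ℝ) (q : Fin n → unitInterval) : Prop :=
  ∃ o, (∀ j ≠ o, (q j : ℝ) + ε ≤ q o) ∧ ∃ j ≠ o, (q j : ℝ) + ε = q o

/-- Some arm that is optimal for `q` is more than `ε` below the optimum of `q'`. -/
def Shifts (ε : ℝ) (q q' : Fin n → unitInterval) : Prop :=
  ∃ i, IsOptimal q i ∧ (q' i : ℝ) < best q' - ε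

theorem Shifts.ne {ε : ℝ} (hε : 0 ≤ ε) {q q' : Fin n → unitInterval} (h : Shifts ε q q') :
    q ≠ q' := by
  rintro rfl
  obtain ⟨i, hi, hlt⟩ := h
  rw [best_eq hi] at hlt
  linarith

theorem isOptimal_of_add_le {ε : ℝ} (hε : 0 ≤ ε) {q : Fin n → unitInterval} {o : Fin n}
    (h : ∀ j ≠ o, (q j : ℝ) + ε ≤ q o) : IsOptimal q o := fun j => by
  by_cases hj : j = o
  · rw [hj]
  · exact Subtype.coe_le_coe.1 (by linarith [h j hj])

theorem hasMinSuboptimality_of_hasGap {X : Type u} {F : Set (X → EventLabel)} {T : ℕ}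
    {I : Instance F T n} {ε : ℝ} (hε : 0 < ε) (hT : 0 < T) (h : ∀ t < T, HasGap ε (I.p t)) :
    HasMinSuboptimality I ε := by
  constructor
  · obtain ⟨o, ho, j, hj, hjo⟩ := h 0 hT
    exact ⟨0, hT, o, j, isOptimal_of_add_le hε.le ho, hj, by linarith⟩
  · rintro δ ⟨t, ht, i, j, hi, hji, rfl⟩
    obtain ⟨o, ho, -⟩ := h t ht
    have hio : i = o := by
      by_contra hne
      have h1 : (I.p t o : ℝ) ≤ I.p t i := hi o
      linarith [ho i hne]
    subst hio
    linarith [ho j hji]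

end Gaps

theorem sub_one_mul_le_sum_range {f : ℕ → ℝ} (hf : ∀ t, 0 ≤ f t) {L m T : ℕ} {B : ℝ}
    (hm : 1 ≤ m) (hT : m * L ≤ T)
    (h : ∀ i, 1 ≤ i → i < m → B ≤ ∑ t ∈ Finset.Ico (i * L) (i * L + L), f t) :
    ((m : ℝ) - 1) * B ≤ ∑ t ∈ Finset.range T, f t := by
  refine le_trans ?_ (Finset.sum_le_sum_of_subset_of_nonneg
    (Finset.range_subset_range.2 hT) fun t _ _ => hf t)
  clear hT
  induction m, hm using Nat.le_induction with
  | base => simpa using Finset.sum_nonneg fun t _ => hf t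
  | succ m hm ih =>
    have h1 := ih fun i hi him => h i hi (him.trans m.lt_succ_self)
    have h2 := h m hm m.lt_succ_self
    rw [add_mul, one_mul, Finset.range_eq_Ico,
      ← Finset.sum_Ico_consecutive f (Nat.zero_le (m * L)) (Nat.le_add_right _ L),
      ← Finset.range_eq_Ico]
    push_cast
    linarith

/-! ### Known events -/

section KnownEvents

variable {X : Type u} {n : ℕ}

/-- Whatever happened before round `s`, there are click probabilities, constant from round `s` on,
for which the algorithm has large regret in the rounds `s, …, s + L - 1`. The arm `o` is demoted,
so that the change in round `s` is a shift if `o` was optimal before; any arm other than `o` and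
the new optimum `o'` can be raised to be the optimum. -/
theorem exists_phase (A : Algorithm X n) (x : ℕ → X) (p₀ : ℕ → Fin n → unitInterval)
    (hn : 3 ≤ n) {ε : ℝ} (hε : 0 < ε) (hε' : ε < 1 / 4) (s : ℕ) {L : ℕ} (hL : 0 < L) {B : ℝ}
    (hB : B ≤ n * Real.log L / (132 * ε)) (hB' : B ≤ ε / 6 * √L) (o : Fin n) :
    ∃ v : Fin n → unitInterval, HasGap ε v ∧ (v o : ℝ) < best v - ε ∧
      B ≤ ∑ t ∈ Finset.Ico s (s + L), roundRegret A (fun t => if t < s then p₀ t else v) x t := by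
  have : Nontrivial (Fin n) := Fin.nontrivial_iff_two_le.2 (by omega)
  obtain ⟨o', ho'⟩ := exists_ne o
  set S : Finset (Fin n) := Finset.univ \ {o, o'} with hS
  have hScard : n - 2 = S.card := by
    rw [hS, Finset.card_sdiff_of_subset (Finset.subset_univ _), Finset.card_pair ho'.symm,
      Finset.card_univ, Fintype.card_fin]
  have memS (m : Fin n) : m ∈ S ↔ m ≠ o ∧ m ≠ o' := by simp [hS]
  obtain ⟨m₀, hm₀⟩ : S.Nonempty := Finset.card_pos.1 (by omega)
  let w (i : Fin n) : ℝ := if i = o' then 1 / 2 else if i = o then 1 / 2 - 2 * ε else 1 / 2 - ε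
  have hw (i : Fin n) : w i ∈ unitInterval := by
    simp only [w]
    split_ifs <;> constructor <;> linarith
  let v : Fin n → unitInterval := fun i => ⟨w i, hw i⟩
  let top : unitInterval := ⟨1 / 2 + ε, by constructor <;> linarith⟩
  let v' (m : Fin n) : Fin n → unitInterval := Function.update v m top
  have hvo' : (v o' : ℝ) = 1 / 2 := by simp [v, w]
  have hvo : (v o : ℝ) = 1 / 2 - 2 * ε := by simp [v, w, ho'.symm]
  have hvS (m : Fin n) (hm : m ∈ S) : (v m : ℝ) = 1 / 2 - ε := by
    simp [v, w, ((memS m).1 hm).1, ((memS m).1 hm).2]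
  have hvle (j : Fin n) (hj : j ≠ o') : (v j : ℝ) + ε ≤ 1 / 2 := by
    simp only [v, w, hj, if_false]
    split_ifs <;> linarith
  have htop (j : Fin n) (hj : j ≠ o') : (v j : ℝ) + ε ≤ v o' := by
    rw [hvo']
    exact hvle j hj
  have hbest : best v = 1 / 2 := by rw [best_eq (isOptimal_of_add_le hε.le htop), hvo']
  have hv'm (m : Fin n) : (v' m m : ℝ) = 1 / 2 + ε := by simp [v', top]
  have hv'j (m j : Fin n) (hj : j ≠ m) : v' m j = v j := by simp [v', hj]
  have htop' (m : Fin n) (j : Fin n) (hj : j ≠ m) : (v' m j : ℝ) + ε ≤ v' m m := by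
    rw [hv'm, hv'j m j hj]
    by_cases h : j = o'
    · rw [h, hvo']
    · linarith [hvle j h]
  have hbest' (m : Fin n) : best (v' m) = 1 / 2 + ε := by
    rw [best_eq (isOptimal_of_add_le hε.le (htop' m)), hv'm]
  have good : HasGap ε v ∧ (v o : ℝ) < best v - ε := by
    refine ⟨⟨o', htop, m₀, ((memS m₀).1 hm₀).2, ?_⟩, ?_⟩
    · rw [hvS m₀ hm₀, hvo']
      ring
    · rw [hvo, hbest]
      linarith
  have good' (m : Fin n) (hm : m ∈ S) : HasGap ε (v' m) ∧ (v' m o : ℝ) < best (v' m) - ε := by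
    obtain ⟨h1, h2⟩ := (memS m).1 hm
    refine ⟨⟨m, htop' m, o', h2.symm, ?_⟩, ?_⟩
    · rw [hv'm, hv'j m o' h2.symm, hvo']
    · rw [hv'j m o h1.symm, hvo, hbest' m]
      linarith
  let q (u : Fin n → unitInterval) (t : ℕ) : Fin n → unitInterval := if t < s then p₀ t else u
  have hq {u : Fin n → unitInterval} {t : ℕ} (ht : t ∈ Finset.Ico s (s + L)) : q u t = u :=
    if_neg (not_lt.2 (Finset.mem_Ico.1 ht).1)
  have dich (m : Fin n) (hm : m ∈ S) := by
    refine log_le_or_sqrt_le_sum_roundRegret_add A (q v) (q (v' m)) x (s := s) (L := L) (i₀ := m)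
      (δ := ε) (κ := 22 * ε ^ 2) hL hε.le ?_ ?_ ?_ ?_ ?_
    · rintro t - i (h | h)
      · simp [q, h]
      · simp only [q]
        split_ifs
        · rfl
        · exact (hv'j m i h).symm
    · intro t ht
      rw [hq ht, hvS m hm]
      constructor <;> linarith
    · intro t ht
      rw [hq ht, hv'm]
      constructor <;> linarith
    · intro t ht
      rw [hq ht, hq ht, hv'm, hvS m hm]
      have h1 : ε ^ 2 ≤ 1 / 16 := by nlinarith
      nlinarith [mul_le_mul_of_nonneg_left h1 (sq_nonneg ε)]
    · intro t ht i
      rw [hq ht, hq ht]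
      by_cases hi : i = o'
      · rw [hi, hbest, hbest', hvo', hv'j m o' ((memS m).1 hm).2.symm, hvo']
        linarith
      · have h1 := hvle i hi
        have h2 := le_best (v' m) i
        rw [hbest]
        linarith
  by_cases hall : ∀ m ∈ S, Real.log L ≤
      2 * (22 * ε ^ 2) * ∑ t ∈ Finset.Ico s (s + L), playProb A (q v) x t m
  · refine ⟨v, good.1, good.2, hB.trans ?_⟩
    have h1 : ε * ∑ m ∈ S, ∑ t ∈ Finset.Ico s (s + L), playProb A (q v) x t m ≤
        ∑ t ∈ Finset.Ico s (s + L), roundRegret A (q v) x t := by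
      rw [Finset.sum_comm, Finset.mul_sum]
      refine Finset.sum_le_sum fun t ht =>
        mul_sum_playProb_le_roundRegret A (q v) x S fun m hm => ?_
      rw [hq ht, hbest, hvS m hm]
      linarith
    have h2 : S.card • Real.log L ≤
        ∑ m ∈ S, 2 * (22 * ε ^ 2) * ∑ t ∈ Finset.Ico s (s + L), playProb A (q v) x t m :=
      Finset.card_nsmul_le_sum _ _ _ hall
    rw [← Finset.mul_sum, nsmul_eq_mul, ← hScard, Nat.cast_sub (by omega)] at h2
    have hn' : (3 : ℝ) ≤ n := by exact_mod_cast hn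
    have hlog : 0 ≤ Real.log L := Real.log_natCast_nonneg L
    refine le_trans ?_ h1
    rw [div_le_iff₀ (by positivity)]
    push_cast at h2
    nlinarith [mul_nonneg (sub_nonneg.2 hn') hlog]
  · push Not at hall
    obtain ⟨m, hm, hlt⟩ := hall
    rcases (dich m hm).resolve_left (not_le.2 hlt) with h | h
    · exact ⟨v, good.1, good.2, hB'.trans h⟩
    · exact ⟨v' m, (good' m hm).1, (good' m hm).2, hB'.trans h⟩

/-- Phases of length `L` can be chosen one after the other, since the regret in a phase does not
depend on the later ones. -/
theorem exists_phases (A : Algorithm X n) (x : ℕ → X)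
    (hn : 3 ≤ n) {ε : ℝ} (hε : 0 < ε) (hε' : ε < 1 / 4) {L : ℕ} (hL : 0 < L) {B : ℝ}
    (hB : B ≤ n * Real.log L / (132 * ε)) (hB' : B ≤ ε / 6 * √L) (k : ℕ) :
    ∃ q : ℕ → Fin n → unitInterval, (∀ i, HasGap ε (q i)) ∧
      (∀ i < k, Shifts ε (q i) (q (i + 1))) ∧
      ∀ i, 1 ≤ i → i ≤ k →
        B ≤ ∑ t ∈ Finset.Ico (i * L) (i * L + L), roundRegret A (fun t => q (t / L)) x t := by
  induction k with
  | zero =>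
    obtain ⟨v, hv, -⟩ := exists_phase A x (fun _ _ => 0) hn hε hε' 0 hL hB hB' ⟨0, by omega⟩
    exact ⟨fun _ => v, fun _ => hv, fun i hi => absurd hi i.not_lt_zero, fun i h1 h2 => by omega⟩
  | succ k ih =>
    obtain ⟨q, hgap, hshift, hreg⟩ := ih
    obtain ⟨o, ho, -⟩ := hgap k
    obtain ⟨v, hv, hvo, hvreg⟩ :=
      exists_phase A x (fun t => q (t / L)) hn hε hε' ((k + 1) * L) hL hB hB' o
    have hold {i : ℕ} (hi : i ≤ k) : Function.update q (k + 1) v i = q i :=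
      Function.update_of_ne (by omega) ..
    refine ⟨Function.update q (k + 1) v, fun i => ?_, fun i hi => ?_, fun i h1 hi => ?_⟩
    · by_cases h : i = k + 1
      · simpa [h] using hv
      · simpa [h] using hgap i
    · rw [hold (Nat.lt_succ_iff.1 hi)]
      rcases (Nat.lt_succ_iff.1 hi).lt_or_eq with h | rfl
      · rw [hold h]
        exact hshift i h
      · rw [Function.update_self]
        exact ⟨o, isOptimal_of_add_le hε.le ho, hvo⟩
    · rcases hi.lt_or_eq with h | rfl
      · refine (hreg i h1 (Nat.lt_succ_iff.1 h)).trans_eq (Finset.sum_congr rfl fun t ht => ?_)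
        refine roundRegret_congr A _ _ _ _ (fun r hr => ?_) fun _ _ => rfl
        have : r / L < i + 1 := (Nat.div_lt_iff_lt_mul hL).2 (by
          rw [add_mul, one_mul]
          exact hr.trans_lt (Finset.mem_Ico.1 ht).2)
        exact (hold (by omega)).symm
      · refine hvreg.trans_eq (Finset.sum_congr rfl fun t ht => ?_)
        refine roundRegret_congr A _ _ _ _ (fun r hr => ?_) fun _ _ => rfl
        have h2 : r / L < k + 1 + 1 := (Nat.div_lt_iff_lt_mul hL).2 (by
          rw [add_mul _ 1, one_mul]
          exact hr.trans_lt (Finset.mem_Ico.1 ht).2)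
        split_ifs with h3
        · rw [hold (Nat.lt_succ_iff.1 ((Nat.div_lt_iff_lt_mul hL).2 h3))]
        · have h4 : k + 1 ≤ r / L := (Nat.le_div_iff_mul_le hL).2 (not_lt.1 h3)
          rw [show r / L = k + 1 by omega, Function.update_self]

/-- With events at the multiples of `L`, announced by the context `a`, each of the `k` phases that
follow them costs the algorithm `B`. -/
theorem exists_instance_of_known_events (A : Algorithm X n) {F : Set (X → EventLabel)}
    (hF : Nondegenerate F) (hn : 3 ≤ n) {ε : ℝ} (hε : 0 < ε) (hε' : ε < 1 / 4) {L : ℕ}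
    (hL : 0 < L) {B : ℝ} (hB : B ≤ n * Real.log L / (132 * ε)) (hB' : B ≤ ε / 6 * √L) {k T : ℕ}
    (hT : (k + 1) * L ≤ T) :
    ∃ I : Instance F T n, numEvents I = k ∧ HasMinShift I ε ∧ HasMinSuboptimality I ε ∧
      k * B ≤ regret A I := by
  classical
  obtain ⟨f, hf, ⟨a, ha⟩, b, hb⟩ := hF
  let x (t : ℕ) : X := if L ∣ t ∧ 1 ≤ t / L ∧ t / L ≤ k then a else b
  obtain ⟨q, hgap, hshift, hreg⟩ := exists_phases A x hn hε hε' hL hB hB' k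
  let p (t : ℕ) : Fin n → unitInterval := q (min (t / L) k)
  have hstep (s : ℕ) (h : L ∣ s + 1 ∧ 1 ≤ (s + 1) / L ∧ (s + 1) / L ≤ k) :
      Shifts ε (p s) (p (s + 1)) := by
    have hs := Nat.succ_div (a := s) (b := L)
    rw [if_pos h.1] at hs
    have e1 : min (s / L) k = s / L := min_eq_left (by omega)
    have e2 : min ((s + 1) / L) k = s / L + 1 := by omega
    simp only [p, e1, e2]
    exact hshift _ (by omega)
  have hevent (s : ℕ) : p s ≠ p (s + 1) ↔ L ∣ s + 1 ∧ 1 ≤ (s + 1) / L ∧ (s + 1) / L ≤ k := by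
    refine ⟨fun hne => ?_, fun h => (hstep s h).ne hε.le⟩
    by_contra hcon
    refine hne ?_
    have hs := Nat.succ_div (a := s) (b := L)
    have e : min (s / L) k = min ((s + 1) / L) k := by
      generalize s / L = u at hs ⊢
      split_ifs at hs with hd
      · have : ¬(1 ≤ (s + 1) / L ∧ (s + 1) / L ≤ k) := fun h => hcon ⟨hd, h⟩
        omega
      · omega
    simp only [p, e]
  have hIs (t : ℕ) : IsEvent p t ↔ L ∣ t ∧ 1 ≤ t / L ∧ t / L ≤ k := by
    cases t with
    | zero => simp [IsEvent]
    | succ s =>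
      rw [← hevent s]
      exact ⟨fun ⟨r, hr, h⟩ => by rwa [← Nat.succ_injective hr] at h, fun h => ⟨s, rfl, h⟩⟩
  let I : Instance F T n :=
    { p := p
      x := x
      f := f
      f_mem := hf
      oracle_pos := fun t _ h => by simp only [x, if_pos ((hIs t).1 h), ha]
      oracle_neg := fun t _ h => by simp only [x, if_neg fun h' => h ((hIs t).2 h'), hb] }
  have hTpos : 0 < T := lt_of_lt_of_le (by positivity) hT
  refine ⟨I, ?_, fun t _ hne => hstep t ((hevent t).1 hne),
    hasMinSuboptimality_of_hasGap hε hTpos fun t _ => hgap _, ?_⟩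
  · have : {t | t < T ∧ IsEvent I.p t} = ((Finset.Icc 1 k).image (· * L) : Finset ℕ) := by
      ext t
      simp only [Set.mem_ofPred_eq, Finset.coe_image, Set.mem_image, Finset.mem_coe,
        Finset.mem_Icc, I, hIs]
      constructor
      · rintro ⟨-, h1, h2⟩
        exact ⟨t / L, h2, Nat.div_mul_cancel h1⟩
      · rintro ⟨i, hi, rfl⟩
        rw [Nat.mul_div_cancel _ hL]
        refine ⟨lt_of_lt_of_le ?_ hT, Dvd.intro_left i rfl, hi⟩
        exact Nat.mul_lt_mul_of_pos_right (by omega) hL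
    rw [numEvents, this, Set.ncard_coe_finset,
      Finset.card_image_of_injective _ (fun i j h => Nat.eq_of_mul_eq_mul_right hL h), Nat.card_Icc,
      Nat.add_sub_cancel]
  · rw [regret_eq_sum_roundRegret]
    have := sub_one_mul_le_sum_range (f := roundRegret A p x) (roundRegret_nonneg A p x)
      (B := B) (Nat.le_add_left 1 k) hT fun i h1 hi => by
        refine (hreg i h1 (Nat.lt_succ_iff.1 hi)).trans_eq (Finset.sum_congr rfl fun t ht => ?_)
        refine roundRegret_congr A _ _ _ _ (fun r hr => ?_) fun _ _ => rfl
        have : r / L < i + 1 := (Nat.div_lt_iff_lt_mul hL).2 (by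
          rw [add_mul, one_mul]
          exact hr.trans_lt (Finset.mem_Ico.1 ht).2)
        simp only [p, min_eq_left (show r / L ≤ k by omega)]
    push_cast at this
    rwa [add_sub_cancel_right] at this

/-- `log` is eventually below any multiple of the square root. -/
theorem exists_forall_log_le_mul_sqrt {c : ℝ} (hc : 0 < c) :
    ∃ τ, ∀ z, τ ≤ z → Real.log z ≤ c * √z := by
  have h := (isLittleO_log_rpow_atTop (r := 1 / 2) (by norm_num)).bound hc
  obtain ⟨τ, hτ⟩ := Filter.eventually_atTop.1 h
  refine ⟨τ, fun z hz => (le_abs_self _).trans ?_⟩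
  have := hτ z hz
  rwa [← Real.sqrt_eq_rpow, Real.norm_eq_abs, Real.norm_eq_abs,
    abs_of_nonneg (Real.sqrt_nonneg z)] at this

theorem exists_instance_le_regret_of_le_mul (hn : 3 ≤ n) {ε : ℝ} (hε : 0 < ε)
    (hε' : ε < 1 / 4) :
    ∃ τ : ℝ, ∀ k T : ℕ, 1 ≤ k → τ * (k : ℝ) ≤ (T : ℝ) →
      ∀ (X : Type u) (F : Set (X → EventLabel)), Nondegenerate F → ∀ A : Algorithm X n,
        ∃ I : Instance F T n, numEvents I = k ∧ HasMinShift I ε ∧ HasMinSuboptimality I ε ∧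
          1 / 264 * ((k : ℝ) * (n : ℝ) / ε) * Real.log ((T : ℝ) / (k : ℝ)) ≤ regret A I := by
  have hn0 : (0 : ℝ) < n := by exact_mod_cast (by omega : 0 < n)
  obtain ⟨τ, hτ⟩ := exists_forall_log_le_mul_sqrt (c := 22 * ε ^ 2 / n) (by positivity)
  refine ⟨max τ 16, fun k T hk hkT X F hF A => ?_⟩
  have hk0 : (0 : ℝ) < k := by exact_mod_cast hk
  have hk1 : (1 : ℝ) ≤ k := by exact_mod_cast hk
  set z : ℝ := T / k with hz
  have hzmax : max τ 16 ≤ z := (le_div_iff₀ hk0).2 hkT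
  have hz16 : 16 ≤ z := (le_max_right _ _).trans hzmax
  have hlogz := hτ z ((le_max_left _ _).trans hzmax)
  have hLz : z / 4 ≤ (T / (k + 1) : ℕ) := by
    have h1 : (T : ℝ) / ((k : ℝ) + 1) < (T / (k + 1) : ℕ) + 1 := by
      have := Nat.lt_floor_add_one ((T : ℝ) / ((k + 1 : ℕ) : ℝ))
      rw [Nat.floor_div_eq_div] at this
      exact_mod_cast this
    have h2 : z / 2 ≤ (T : ℝ) / ((k : ℝ) + 1) := by
      rw [hz, div_div]
      exact div_le_div_of_nonneg_left (Nat.cast_nonneg T) (by linarith) (by linarith)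
    linarith
  set L : ℕ := T / (k + 1) with hLdef
  have hL0 : (0 : ℝ) < L := by linarith
  have hlogL : Real.log z / 2 ≤ Real.log L := by
    have h1 : Real.log z = 2 * Real.log √z := by
      rw [Real.log_sqrt (by linarith)]
      ring
    have h2 : √z ≤ z / 4 := by
      rw [Real.sqrt_le_left (by linarith)]
      nlinarith
    have h3 : Real.log √z ≤ Real.log L :=
      Real.log_le_log (Real.sqrt_pos.2 (by linarith)) (h2.trans hLz)
    linarith
  have hsqrtL : √z / 2 ≤ √L := by
    refine Real.le_sqrt_of_sq_le ?_
    rw [div_pow, Real.sq_sqrt (by linarith)]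
    linarith
  obtain ⟨I, h1, h2, h3, h4⟩ := exists_instance_of_known_events A hF hn hε hε'
    (L := L) (k := k) (T := T) (B := n / (264 * ε) * Real.log z) (by exact_mod_cast hL0)
    (by
      rw [div_mul_eq_mul_div, div_le_div_iff₀ (by positivity) (by positivity)]
      have : 0 ≤ n * ε * (Real.log L - Real.log z / 2) :=
        mul_nonneg (by positivity) (by linarith)
      linarith)
    (by
      calc n / (264 * ε) * Real.log z ≤ n / (264 * ε) * (22 * ε ^ 2 / n * √z) :=
            mul_le_mul_of_nonneg_left hlogz (by positivity)
        _ = ε / 6 * (√z / 2) := by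
            field_simp
            norm_num
        _ ≤ _ := mul_le_mul_of_nonneg_left hsqrtL (by positivity))
    (Nat.mul_div_le T (k + 1))
  refine ⟨I, h1, h2, h3, le_trans (le_of_eq ?_) h4⟩
  field_simp

end KnownEvents

/-! ### A hidden event -/

section HiddenEvent

/-- Two arms; the second one is inferior. -/
noncomputable def lowArms : Fin 2 → unitInterval :=
  ![⟨1 / 2, by norm_num, by norm_num⟩, ⟨1 / 4, by norm_num, by norm_num⟩]

/-- Two arms; the second one is superior. The first one is as in `lowArms`, so that only plays of
the second arm tell the two situations apart. -/
noncomputable def highArms : Fin 2 → unitInterval :=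
  ![⟨1 / 2, by norm_num, by norm_num⟩, ⟨3 / 4, by norm_num, by norm_num⟩]

theorem lowArms_zero : (lowArms 0 : ℝ) = 1 / 2 := rfl

theorem lowArms_one : (lowArms 1 : ℝ) = 1 / 4 := rfl

theorem highArms_zero : (highArms 0 : ℝ) = 1 / 2 := rfl

theorem highArms_one : (highArms 1 : ℝ) = 3 / 4 := rfl

theorem isOptimal_lowArms : IsOptimal lowArms 0 := by
  refine isOptimal_of_add_le (ε := 1 / 4) (by norm_num) fun j hj => ?_
  rw [Fin.eq_one_of_ne_zero j hj, lowArms_zero, lowArms_one]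
  norm_num

theorem isOptimal_highArms : IsOptimal highArms 1 := by
  intro j
  rw [← Subtype.coe_le_coe]
  fin_cases j
  · simp only [Fin.zero_eta, highArms_zero, highArms_one]
    norm_num
  · exact le_rfl

theorem best_lowArms : best lowArms = 1 / 2 := best_eq isOptimal_lowArms

theorem best_highArms : best highArms = 3 / 4 := best_eq isOptimal_highArms

theorem hasGap_lowArms : HasGap (1 / 4) lowArms := by
  refine ⟨0, fun j hj => ?_, 1, by decide, ?_⟩
  · rw [Fin.eq_one_of_ne_zero j hj, lowArms_zero, lowArms_one]
    norm_num
  · rw [lowArms_zero, lowArms_one]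
    norm_num

theorem hasGap_highArms : HasGap (1 / 4) highArms := by
  refine ⟨1, fun j hj => ?_, 0, by decide, ?_⟩
  · rw [show j = 0 by omega, highArms_zero, highArms_one]
    norm_num
  · rw [highArms_zero, highArms_one]
    norm_num

theorem shifts_lowArms_highArms : Shifts (1 / 8) lowArms highArms :=
  ⟨0, isOptimal_lowArms, by rw [best_highArms, highArms_zero]; norm_num⟩

theorem shifts_highArms_lowArms : Shifts (1 / 8) highArms lowArms :=
  ⟨1, isOptimal_highArms, by rw [best_lowArms, lowArms_one]; norm_num⟩

theorem gap_le_lowArms_highArms (i : Fin 2) :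
    1 / 4 ≤ (best lowArms - (lowArms i : ℝ)) + (best highArms - (highArms i : ℝ)) := by
  rw [best_lowArms, best_highArms]
  fin_cases i
  · simp only [Fin.zero_eta, lowArms_zero, highArms_zero]
    norm_num
  · simp only [Fin.mk_one, lowArms_one, highArms_one]
    norm_num

variable {X : Type u} {F : Set (X → EventLabel)} {T : ℕ}

/-- An instance whose only event is in round `e`. -/
theorem exists_instance_of_single_event {q q' : Fin 2 → unitInterval} {f : X → EventLabel}
    {x : ℕ → X} {e : ℕ} (hf : f ∈ F) (hq : HasGap (1 / 4) q) (hq' : HasGap (1 / 4) q')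
    (hqq' : Shifts (1 / 8) q q') (he : 0 < e) (heT : e < T) (hpos : f (x e) = EventLabel.pos)
    (hneg : ∀ t ≠ e, f (x t) = EventLabel.neg) :
    ∃ I : Instance F T 2, (numEvents I = 1 ∧ HasMinShift I (1 / 8) ∧
      HasMinSuboptimality I (1 / 4)) ∧ I.x = x ∧ I.p = fun t => if t < e then q else q' := by
  set p : ℕ → Fin 2 → unitInterval := fun t => if t < e then q else q' with hp
  have hne := hqq'.ne (by norm_num)
  have hstep (s : ℕ) : p s ≠ p (s + 1) ↔ s + 1 = e := by
    simp only [hp]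
    split_ifs <;> simp [hne] <;> omega
  have hIs (t : ℕ) : IsEvent p t ↔ t = e := by
    cases t with
    | zero => simp [IsEvent, he.ne]
    | succ s =>
      rw [← hstep s]
      exact ⟨fun ⟨r, hr, h⟩ => by rwa [← Nat.succ_injective hr] at h, fun h => ⟨s, rfl, h⟩⟩
  refine ⟨{ p := p
            x := x
            f := f
            f_mem := hf
            oracle_pos := fun t _ h => by rw [(hIs t).1 h, hpos]
            oracle_neg := fun t _ h => hneg t fun h' => h ((hIs t).2 h') },
    ⟨?_, fun t _ hpt => ?_, ?_⟩, rfl, rfl⟩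
  · rw [numEvents, Set.ncard_eq_one]
    refine ⟨e, Set.ext fun t => ?_⟩
    simp only [Set.mem_ofPred_eq, hIs, Set.mem_singleton_iff]
    exact ⟨fun h => h.2, fun h => ⟨h ▸ heT, h⟩⟩
  · have := (hstep t).1 hpt
    have e1 : p t = q := if_pos (by omega)
    have e2 : p (t + 1) = q' := if_neg (by omega)
    simpa only [Shifts, e1, e2] using hqq'
  · refine hasMinSuboptimality_of_hasGap (by norm_num) (by omega) fun t _ => ?_
    simp only [hp]
    split_ifs
    · exact hq
    · exact hq'

theorem sum_Ico_roundRegret_le_regret {n : ℕ} (A : Algorithm X n) (I : Instance F T n)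
    {s r : ℕ} (hr : r ≤ T) :
    ∑ t ∈ Finset.Ico s r, roundRegret A I.p I.x t ≤ regret A I := by
  rw [regret_eq_sum_roundRegret]
  exact Finset.sum_le_sum_of_subset_of_nonneg
    (fun t ht => Finset.mem_range.2 ((Finset.mem_Ico.1 ht).2.trans_le hr))
    fun t _ _ => roundRegret_nonneg ..

/-- Over `L` rounds an algorithm either plays the second arm often although it is inferior,
or has large regret. -/
theorem log_le_or_sqrt_le_of_lowArms_highArms (A : Algorithm X 2)
    (p p' : ℕ → Fin 2 → unitInterval) (x : ℕ → X) {s L : ℕ} (hL : 0 < L)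
    (hagree : ∀ t < s, p t = p' t) (hp : ∀ t ∈ Finset.Ico s (s + L), p t = lowArms)
    (hp' : ∀ t ∈ Finset.Ico s (s + L), p' t = highArms) :
    3 / 32 * Real.log L ≤ ∑ t ∈ Finset.Ico s (s + L), roundRegret A p x t ∨
      √L / 24 ≤ ∑ t ∈ Finset.Ico s (s + L), roundRegret A p x t ∨
      √L / 24 ≤ ∑ t ∈ Finset.Ico s (s + L), roundRegret A p' x t := by
  have h := log_le_or_sqrt_le_sum_roundRegret_add A p p' x (s := s) (L := L) (i₀ := 1)
    (δ := 1 / 4) (κ := 4 / 3) hL (by norm_num)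
    (fun t ht i hi => by
      by_cases hts : t < s
      · rw [hagree t hts]
      · have hm := Finset.mem_Ico.2 ⟨not_lt.1 hts, ht⟩
        have hi0 : i = 0 := by
          have := hi.resolve_left hts
          omega
        rw [hp t hm, hp' t hm, hi0]
        rfl)
    (fun t ht => by rw [hp t ht, lowArms_one]; norm_num)
    (fun t ht => by rw [hp' t ht, highArms_one]; norm_num)
    (fun t ht => by rw [hp t ht, hp' t ht, lowArms_one, highArms_one]; norm_num)
    (fun t ht i => by
      rw [hp t ht, hp' t ht]
      exact gap_le_lowArms_highArms i)
  rw [show (1 / 4 : ℝ) / 6 * √L = √L / 24 by ring] at h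
  refine h.imp_left fun h => ?_
  have hreg : 1 / 4 * ∑ t ∈ Finset.Ico s (s + L), playProb A p x t 1 ≤
      ∑ t ∈ Finset.Ico s (s + L), roundRegret A p x t := by
    rw [Finset.mul_sum]
    refine Finset.sum_le_sum fun t ht => ?_
    have := mul_sum_playProb_le_roundRegret A p x (t := t) (δ := 1 / 4) {1} fun i hi => by
      rw [Finset.mem_singleton.1 hi, hp t ht, best_lowArms, lowArms_one]
      norm_num
    rwa [Finset.sum_singleton] at this
  linarith

/-- For every class of concepts: the only event is in the last round, and the algorithm does not
know which arm is better before it. -/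
theorem exists_instance_of_unknown_arm (A : Algorithm X 2) (hF : Nondegenerate F) {L : ℕ}
    (hL : 0 < L) (hT : L + 1 = T) :
    ∃ I : Instance F T 2, (numEvents I = 1 ∧ HasMinShift I (1 / 8) ∧
      HasMinSuboptimality I (1 / 4)) ∧
      (√L / 24 ≤ regret A I ∨ 3 / 32 * Real.log L ≤ regret A I) := by
  obtain ⟨f, hf, ⟨a, ha⟩, b, hb⟩ := hF
  let x (t : ℕ) : X := if t = L then a else b
  have hpos : f (x L) = EventLabel.pos := by simp [x, ha]
  have hneg : ∀ t ≠ L, f (x t) = EventLabel.neg := fun t ht => by simp [x, ht, hb]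
  obtain ⟨I, hI, hIx, hIp⟩ := exists_instance_of_single_event (T := T) hf hasGap_lowArms
    hasGap_highArms shifts_lowArms_highArms hL (by omega) hpos hneg
  obtain ⟨I', hI', hIx', hIp'⟩ := exists_instance_of_single_event (T := T) hf hasGap_highArms
    hasGap_lowArms shifts_highArms_lowArms hL (by omega) hpos hneg
  have hR := sum_Ico_roundRegret_le_regret A I (s := 0) (r := 0 + L) (by omega)
  have hR' := sum_Ico_roundRegret_le_regret A I' (s := 0) (r := 0 + L) (by omega)
  rw [hIx] at hR
  rw [hIx'] at hR'
  have h := log_le_or_sqrt_le_of_lowArms_highArms A I.p I'.p x (s := 0) hL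
    (fun t ht => absurd ht t.not_lt_zero)
    (fun t ht => by rw [hIp]; exact if_pos (by simpa using ht))
    (fun t ht => by rw [hIp']; exact if_pos (by simpa using ht))
  rcases h with h | h | h
  · exact ⟨I, hI, Or.inr (h.trans hR)⟩
  · exact ⟨I, hI, Or.inl (h.trans hR)⟩
  · exact ⟨I', hI', Or.inl (h.trans hR')⟩

/-- The members of a diameter sequence are shown one by one, each followed by `L - 1` rounds with
its first member as the context. At each of the members with index `1, …, m - 2` the algorithm
cannot tell from the contexts whether there was an event, until the next member is shown: either it
plays the second arm often after every one of them, in the instance whose event is at the last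
member, or it has large regret if the event is at some earlier member. -/
theorem exists_instance_of_isDiameterSeq (A : Algorithm X 2) {m : ℕ} (hm : 3 ≤ m)
    {y : Fin m → X} (hy : IsDiameterSeq F m y) {L : ℕ} (hL : 0 < L) (hT : m * L ≤ T) :
    ∃ I : Instance F T 2, (numEvents I = 1 ∧ HasMinShift I (1 / 8) ∧
      HasMinSuboptimality I (1 / 4)) ∧
      (√L / 24 ≤ regret A I ∨ ((m : ℝ) - 2) * (3 / 32 * Real.log L) ≤ regret A I) := by
  classical
  let y' (i : ℕ) : X := if h : i < m then y ⟨i, h⟩ else y ⟨0, by omega⟩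
  have hy' (i : ℕ) (hi : i < m) : ∃ f ∈ F, f (y' i) = EventLabel.pos ∧
      ∀ j < i, f (y' j) = EventLabel.neg := by
    obtain ⟨f, hf, h1, h2⟩ := hy ⟨i, hi⟩
    refine ⟨f, hf, by simpa [y', hi] using h1, fun j hj => ?_⟩
    simpa [y', hj.trans hi] using h2 ⟨j, hj.trans hi⟩ hj
  have hy0 (i : ℕ) (hi : m ≤ i) : y' i = y' 0 := by
    simp [y', not_lt.2 hi, show 0 < m by omega]
  -- The contexts: `y' i` in round `i * L` and `y' 0` elsewhere.
  let x (t : ℕ) : X := if L ∣ t then y' (t / L) else y' 0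
  have hxmul (i : ℕ) : x (i * L) = y' i := by simp [x, Nat.mul_div_cancel _ hL]
  have hx (t : ℕ) : (∃ i, t = i * L ∧ x t = y' i) ∨ x t = y' 0 := by
    by_cases h : L ∣ t
    · obtain ⟨i, rfl⟩ := h
      rw [mul_comm L i]
      exact Or.inl ⟨i, rfl, hxmul i⟩
    · exact Or.inr (by simp [x, h])
  have hmT : (m - 1) * L < T := lt_of_lt_of_le (Nat.mul_lt_mul_of_pos_right (by omega) hL) hT
  -- The instance with the event at the last member of the sequence.
  obtain ⟨f, hf, hfpos, hfneg⟩ := hy' (m - 1) (by omega)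
  obtain ⟨I, hI, hIx, hIp⟩ := exists_instance_of_single_event (T := T) (x := x)
    (e := (m - 1) * L) hf hasGap_lowArms hasGap_highArms shifts_lowArms_highArms
    (Nat.mul_pos (by omega) hL) hmT (by rw [hxmul, hfpos]) fun t ht => by
      rcases hx t with ⟨i, rfl, h⟩ | h
      · rw [h]
        by_cases him : m ≤ i
        · rw [hy0 i him]
          exact hfneg 0 (by omega)
        · exact hfneg i (by
            have : i ≠ m - 1 := fun h => ht (by rw [h])
            omega)
      · rw [h]
        exact hfneg 0 (by omega)
  by_cases hall : ∀ s, 1 ≤ s → s < m - 1 → 3 / 32 * Real.log L ≤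
      ∑ t ∈ Finset.Ico (s * L) (s * L + L), roundRegret A I.p I.x t
  · refine ⟨I, hI, Or.inr ?_⟩
    rw [regret_eq_sum_roundRegret]
    have h := sub_one_mul_le_sum_range (roundRegret_nonneg A I.p I.x) (T := T)
      (show 1 ≤ m - 1 by omega) hmT.le hall
    rw [Nat.cast_sub (by omega : 1 ≤ m)] at h
    norm_num at h ⊢
    linarith
  · push Not at hall
    obtain ⟨s, hs1, hsm, hlt⟩ := hall
    have hsL : s * L + L ≤ (m - 1) * L := by
      rw [← Nat.succ_mul]
      exact Nat.mul_le_mul_right L (by omega)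
    -- The instance with the event at the member `s`.
    obtain ⟨f', hf', hfpos', hfneg'⟩ := hy' s (by omega)
    obtain ⟨I', hI', hIx', hIp'⟩ := exists_instance_of_single_event (T := T)
      (x := fun t => if t ≤ s * L then x t else y' 0)
      (e := s * L) hf' hasGap_lowArms hasGap_highArms shifts_lowArms_highArms
      (Nat.mul_pos (by omega) hL) (by omega) (by simp only [le_refl, if_true, hxmul, hfpos'])
      fun t ht => by
        by_cases hts : t ≤ s * L
        · simp only [hts, if_true]
          rcases hx t with ⟨i, rfl, h⟩ | h
          · rw [h]
            exact hfneg' i (Nat.lt_of_mul_lt_mul_right (lt_of_le_of_ne hts ht))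
          · rw [h]
            exact hfneg' 0 (by omega)
        · simp only [hts, if_false]
          exact hfneg' 0 (by omega)
    have hxI' : ∀ r < s * L + L, I.x r = I'.x r := fun r hr => by
      rw [hIx, hIx']
      by_cases hrs : r ≤ s * L
      · simp [hrs]
      · simp only [hrs, if_false]
        have : ¬ L ∣ r := by
          rintro ⟨i, rfl⟩
          rw [mul_comm L i] at hr hrs
          have h1 : s < i := Nat.lt_of_mul_lt_mul_right (not_le.1 hrs)
          rw [← Nat.succ_mul] at hr
          have h2 : i < s + 1 := Nat.lt_of_mul_lt_mul_right hr
          omega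
        simp [x, this]
    have h := log_le_or_sqrt_le_of_lowArms_highArms A I.p I'.p I.x (s := s * L) hL
      (fun t ht => by
        rw [hIp, hIp']
        simp only [ht, if_true, show t < (m - 1) * L by omega])
      (fun t ht => by
        rw [hIp]
        exact if_pos ((Finset.mem_Ico.1 ht).2.trans_le hsL))
      (fun t ht => by
        rw [hIp']
        exact if_neg (not_lt.2 (Finset.mem_Ico.1 ht).1))
    rcases h.resolve_left (not_le.2 hlt) with h | h
    · exact ⟨I, hI, Or.inl (h.trans (sum_Ico_roundRegret_le_regret A I (by omega)))⟩
    · refine ⟨I', hI', Or.inl (h.trans ?_)⟩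
      refine le_of_eq_of_le (Finset.sum_congr rfl fun t ht => ?_)
        (sum_Ico_roundRegret_le_regret A I' (s := s * L) (r := s * L + L) (by omega))
      exact roundRegret_congr A _ _ _ _ (fun _ _ => rfl) fun r hr =>
        hxI' r (hr.trans_lt (Finset.mem_Ico.1 ht).2)

theorem IsDiameterSeq.castLE {m m' : ℕ} (h : m ≤ m') {y : Fin m' → X}
    (hy : IsDiameterSeq F m' y) : IsDiameterSeq F m fun i => y (Fin.castLE h i) := fun t => by
  obtain ⟨f, hf, h1, h2⟩ := hy (Fin.castLE h t)
  exact ⟨f, hf, h1, fun s hs => h2 _ hs⟩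

theorem exists_isDiameterSeq_of_le_diameter {m : ℕ} (h : (m : ℕ∞) ≤ diameter F) :
    ∃ y : Fin m → X, IsDiameterSeq F m y := by
  cases m with
  | zero => exact ⟨Fin.elim0, fun t => t.elim0⟩
  | succ m =>
    by_contra hcon
    have : diameter F ≤ m := iSup₂_le fun m' ⟨y, hy⟩ => by
      by_contra hlt
      have hle : m + 1 ≤ m' := by exact_mod_cast not_le.1 hlt
      exact hcon ⟨_, hy.castLE hle⟩
    exact absurd (h.trans this) (by exact_mod_cast Nat.not_succ_le_self m)

theorem exists_instance_of_diameter (hT : 1000 ≤ T) (hF : Nondegenerate F)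
    (A : Algorithm X 2) :
    ∃ I : Instance F T 2, (numEvents I = 1 ∧ HasMinShift I (1 / 8) ∧
      HasMinSuboptimality I (1 / 4)) ∧
      (1 / 100 * (T : ℝ) ^ (1 / 3 : ℝ) ≤ regret A I ∨
        ∃ d : ℕ, diameter F = (d : ℕ∞) ∧ 1 / 100 * (d : ℝ) * Real.log T ≤ regret A I) := by
  set r : ℝ := (T : ℝ) ^ (1 / 3 : ℝ) with hr
  have hT' : (1000 : ℝ) ≤ T := by exact_mod_cast hT
  have hr0 : 0 ≤ r := Real.rpow_nonneg (by linarith) _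
  have hr3 : r ^ 3 = T := by
    rw [hr, ← Real.rpow_natCast, ← Real.rpow_mul (by linarith)]
    norm_num
  have hr10 : 10 ≤ r := by
    by_contra! h
    have := pow_lt_pow_left₀ h hr0 (n := 3) (by norm_num)
    rw [hr3] at this
    linarith
  have hlogT : Real.log T = 3 * Real.log r := by
    rw [← hr3, Real.log_pow]
    norm_num
  have hlogr : 1 ≤ Real.log r := by
    rw [Real.le_log_iff_exp_le (by linarith)]
    linarith [Real.exp_one_lt_d9]
  -- Blocks of `L` rounds are long enough if `L` is of the order `r ^ 2`.
  have hlog {L : ℕ} (hL : r ^ 2 / 4 ≤ L) : Real.log r ≤ Real.log L :=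
    Real.log_le_log (by linarith) (by nlinarith)
  have hsqrt {L : ℕ} (hL : r ^ 2 / 4 ≤ L) : r / 48 ≤ √L / 24 := by
    have : r / 2 ≤ √L := Real.le_sqrt_of_sq_le (by linarith [div_pow r 2 2])
    linarith
  have hdiv {m : ℕ} (hm0 : 0 < m) (hm : (m : ℝ) ≤ r) : r ^ 2 / 4 ≤ (T / m : ℕ) := by
    have h1 := Nat.lt_floor_add_one ((T : ℝ) / (m : ℝ))
    rw [Nat.floor_div_eq_div] at h1
    have h2 : r ^ 2 ≤ (T : ℝ) / m := by
      rw [le_div_iff₀ (by exact_mod_cast hm0), ← hr3]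
      nlinarith [mul_le_mul_of_nonneg_left hm (sq_nonneg r)]
    nlinarith
  have hpos {L : ℕ} (hL : r ^ 2 / 4 ≤ L) : 0 < L := by
    have : (0 : ℝ) < L := by nlinarith
    exact_mod_cast this
  have hfloor : (⌊r⌋₊ : ℝ) ≤ r := Nat.floor_le hr0
  have hfloor' : r < ⌊r⌋₊ + 1 := Nat.lt_floor_add_one r
  by_cases hM : (⌊r⌋₊ : ℕ∞) ≤ diameter F
  · obtain ⟨y, hy⟩ := exists_isDiameterSeq_of_le_diameter hM
    have hM3 : 3 ≤ ⌊r⌋₊ := Nat.le_floor (by norm_num; linarith)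
    have hL := hdiv (by omega : 0 < ⌊r⌋₊) hfloor
    obtain ⟨I, hI, hreg⟩ :=
      exists_instance_of_isDiameterSeq A hM3 hy (hpos hL) (Nat.mul_div_le T _)
    refine ⟨I, hI, Or.inl ?_⟩
    rcases hreg with h | h
    · linarith [hsqrt hL]
    · have h1 : r / 2 ≤ (⌊r⌋₊ : ℝ) - 2 := by linarith
      have h2 := mul_le_mul h1 (hlogr.trans (hlog hL)) zero_le_one (by linarith)
      linarith
  · obtain ⟨d, hd⟩ := ENat.ne_top_iff_exists.1 (ne_top_of_lt (not_le.1 hM))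
    have hdM : d < ⌊r⌋₊ := by
      rw [← hd] at hM
      exact_mod_cast not_le.1 hM
    by_cases hd3 : 3 ≤ d
    · obtain ⟨y, hy⟩ := exists_isDiameterSeq_of_le_diameter hd.le
      have hL := hdiv (by omega : 0 < d) (le_trans (by exact_mod_cast hdM.le) hfloor)
      obtain ⟨I, hI, hreg⟩ :=
        exists_instance_of_isDiameterSeq A hd3 hy (hpos hL) (Nat.mul_div_le T _)
      refine ⟨I, hI, ?_⟩
      rcases hreg with h | h
      · exact Or.inl (by linarith [hsqrt hL])
      · refine Or.inr ⟨d, hd.symm, ?_⟩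
        have hd3' : (3 : ℝ) ≤ d := by exact_mod_cast hd3
        have h1 : (d : ℝ) / 3 ≤ (d : ℝ) - 2 := by linarith
        have h2 := mul_le_mul h1 (hlog hL) (by linarith) (by linarith)
        have h3 : 0 ≤ (d : ℝ) * Real.log r := by positivity
        rw [hlogT]
        linarith
    · have hL : r ^ 2 / 4 ≤ (T - 1 : ℕ) := by
        rw [Nat.cast_sub (by omega), ← hr3]
        push_cast
        nlinarith [sq_nonneg r]
      obtain ⟨I, hI, hreg⟩ :=
        exists_instance_of_unknown_arm (T := T) A hF (hpos hL) (by omega)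
      refine ⟨I, hI, ?_⟩
      rcases hreg with h | h
      · exact Or.inl (by linarith [hsqrt hL])
      · refine Or.inr ⟨d, hd.symm, ?_⟩
        have hd2 : (d : ℝ) ≤ 2 := by exact_mod_cast (by omega : d ≤ 2)
        have h1 := mul_le_mul_of_nonneg_right hd2 (zero_le_one.trans hlogr)
        have h2 := hlog hL
        rw [hlogT]
        linarith

end HiddenEvent

end EventfulBandit

theorem mainTheorem4 :
    (∃ c : ℝ, 0 < c ∧
      ∀ n : ℕ, 3 ≤ n → ∀ ε : ℝ, 0 < ε → ε < 1 / 4 →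
        ∃ τ : ℝ, ∀ k T : ℕ, 1 ≤ k → τ * (k : ℝ) ≤ (T : ℝ) →
          ∀ (X : Type u) (F : Set (X → EventLabel)), EventfulBandit.Nondegenerate F →
            ∀ A : EventfulBandit.Algorithm X n,
              ∃ I : EventfulBandit.Instance F T n,
                EventfulBandit.numEvents I = k ∧
                EventfulBandit.HasMinShift I ε ∧
                EventfulBandit.HasMinSuboptimality I ε ∧
                c * ((k : ℝ) * (n : ℝ) / ε) * Real.log ((T : ℝ) / (k : ℝ)) ≤
                  EventfulBandit.regret A I) ∧
    (∃ c εS Δ : ℝ, 0 < c ∧ 0 < εS ∧ 0 < Δ ∧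
      ∃ T₀ : ℕ, ∀ T : ℕ, T₀ ≤ T →
        ∀ (X : Type u) (F : Set (X → EventLabel)), EventfulBandit.Nondegenerate F →
          ∀ A : EventfulBandit.Algorithm X 2,
            ∃ I : EventfulBandit.Instance F T 2,
              EventfulBandit.numEvents I = 1 ∧
              EventfulBandit.HasMinShift I εS ∧
              EventfulBandit.HasMinSuboptimality I Δ ∧
              (c * (T : ℝ) ^ (1 / 3 : ℝ) ≤ EventfulBandit.regret A I ∨
                ∃ d : ℕ, EventfulBandit.diameter F = (d : ℕ∞) ∧
                  c * (d : ℝ) * Real.log (T : ℝ) ≤ EventfulBandit.regret A I)) := by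
  refine ⟨⟨1 / 264, by norm_num, fun n hn ε hε hε' =>
    EventfulBandit.exists_instance_le_regret_of_le_mul hn hε hε'⟩,
    1 / 100, 1 / 8, 1 / 4, by norm_num, by norm_num, by norm_num, 1000, fun T hT X F hF A => ?_⟩
  obtain ⟨I, ⟨h1, h2, h3⟩, h4⟩ := EventfulBandit.exists_instance_of_diameter hT hF A
  exact ⟨I, h1, h2, h3, h4⟩
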